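/- \textbf{Theorem 1.} The functor $I$ of idempotent probability measures, acting on compacta and continuous maps, is perfectly metrizable. Definitions. For a compact Hausdorff space $X$, $I(X)$ is the set of functionals $\mu:C(X)\to\mathbb R$ with $\mu(\lambda_X)=\lambda$, $\mu(\lambda_X+\varphi)=\mu(\varphi)+\lambda$ and $\mu(\max\{\varphi,\chi\})=\max\{\mu(\varphi),\mu(\chi)\}$ for all $\lambda\in\mathbb R$ (with $\lambda_X$ the constant function) and $\varphi,\chi\in C(X)$, with the topology of pointwise convergence; $I(X)$ is compact. For continuous $f:X\to Y$ put $I(f)(\mu)(\varphi)=\mu(\varphi\circ f)$. Let $\eta_X:X\to I(X)$, $\eta_X(x)=\delta_x$, $\delta_x(\varphi)=\varphi(x)$, and $\psi_X:I^2(X)\to I(X)$, $\psi_X(M)(\varphi)=M(\overline\varphi)$ with $\overline\varphi(\mu)=\mu(\varphi)$. Put $I^0(X)=X$, $I^{n+1}(X)=I(I^n(X))$. That $I$ is perfectly metrizable means: one can assign to every metric compactum $(X,\rho)$ a metric $\rho_I$ on $I(X)$ generating the topology of $I(X)$ such that, writing $\rho_{I^0}=\rho$ and $\rho_{I^{n+1}}=(\rho_{I^n})_I$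 for the iterated metrics, the following hold for all metric compacta. 1. If $f:X\to Y$ is an isometric embedding, then so is $I(f):(I(X),\rho_I)\to(I(Y),\rho_I)$. 2. $\eta_X:(X,\rho)\to(I(X),\rho_I)$ is an isometric embedding. 3. $\operatorname{diam}(I(X),\rho_I)=\operatorname{diam}(X,\rho)$. 4. (Uniformity) For every continuous $f:X\to Y$ and every $\varepsilon>0$ there is $\delta>0$ such that, for every $n\ge 0$ and $a,b\in I^n(X)$, $\rho_{I^n}(a,b)<\delta$ implies $\rho_{I^n}(I^n(f)(a),I^n(f)(b))<\varepsilon$. 5. $\psi_X:(I^2(X),\rho_{I^2})\to(I(X),\rho_I)$ is non-expanding. 6. $\rho_I(\mu,\delta_{x_0})=\rho_{I^2}(\delta_{\delta_{x_0}},N)$ for all $x_0\in X$, $\mu\in I(X)$ and $N\in\psi_X^{-1}(\mu)$. 7. If $\mu\in I(X)$ and $\rho_I(\mu,\eta_X(X))\ge\varepsilon$, then $\rho_{I^2}(I(\eta_X)(\mu),\eta_{I(X)}(I(X)))\ge\varepsilon$. -/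

import Mathlib

universe u

/-- A functional `μ : C(X) → ℝ` is an idempotent (max-plus) probability measure. -/
structure IsIdempotentProbability {X : Type u} [TopologicalSpace X] (μ : C(X, ℝ) → ℝ) : Prop where
  map_const : ∀ c : ℝ, μ (ContinuousMap.const X c) = c
  map_add_const : ∀ (c : ℝ) (φ : C(X, ℝ)), μ (ContinuousMap.const X c + φ) = μ φ + c
  map_sup : ∀ φ χ : C(X, ℝ), μ (φ ⊔ χ) = max (μ φ) (μ χ)

/-- The set `I(X)` of idempotent probability measures on `X`. -/
def IdempMeas (X : Type u) [TopologicalSpace X] : Type u :=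
  {μ : C(X, ℝ) → ℝ // IsIdempotentProbability μ}

namespace IdempMeas

variable {X Y Z : Type u} [TopologicalSpace X] [TopologicalSpace Y] [TopologicalSpace Z]

instance : CoeFun (IdempMeas X) (fun _ => C(X, ℝ) → ℝ) := ⟨fun μ => μ.1⟩

/-- The topology of pointwise convergence, induced from `ℝ^{C(X)}`. -/
instance : TopologicalSpace (IdempMeas X) :=
  inferInstanceAs (TopologicalSpace {μ : C(X, ℝ) → ℝ // IsIdempotentProbability μ})

theorem ext_apply {μ ν : IdempMeas X} (h : ∀ φ, μ φ = ν φ) : μ = ν :=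
  Subtype.ext (funext h)

theorem continuous_apply (φ : C(X, ℝ)) : Continuous (fun μ : IdempMeas X => μ φ) :=
  (_root_.continuous_apply φ).comp continuous_subtype_val

theorem continuous_of_apply {f : Y → IdempMeas X} (h : ∀ φ, Continuous fun y => f y φ) :
    Continuous f :=
  Continuous.subtype_mk (continuous_pi h) fun y => (f y).2

theorem mono (μ : IdempMeas X) {φ χ : C(X, ℝ)} (h : φ ≤ χ) : μ φ ≤ μ χ := by
  have := μ.2.map_sup φ χ
  rw [sup_eq_right.2 h] at this
  rw [this]
  exact le_max_left _ _

/-- `I(X)` is compact when `X` is. -/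
instance [CompactSpace X] : CompactSpace (IdempMeas X) := by
  have hc : IsClosed {μ : C(X, ℝ) → ℝ | IsIdempotentProbability μ} := by
    have : {μ : C(X, ℝ) → ℝ | IsIdempotentProbability μ} =
        (⋂ c : ℝ, {μ | μ (ContinuousMap.const X c) = c}) ∩
        ((⋂ (c : ℝ) (φ : C(X, ℝ)), {μ | μ (ContinuousMap.const X c + φ) = μ φ + c}) ∩
        (⋂ (φ : C(X, ℝ)) (χ : C(X, ℝ)), {μ | μ (φ ⊔ χ) = max (μ φ) (μ χ)})) := by
      ext μ
      simp only [Set.mem_inter_iff, Set.mem_iInter, Set.mem_ofPred_eq]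
      exact ⟨fun h => ⟨h.1, h.2, h.3⟩, fun h => ⟨h.1, h.2.1, h.2.2⟩⟩
    rw [this]
    refine IsClosed.inter ?_ (IsClosed.inter ?_ ?_)
    · exact isClosed_iInter fun c => isClosed_eq (by fun_prop) (by fun_prop)
    · exact isClosed_iInter fun c => isClosed_iInter fun φ =>
        isClosed_eq (by fun_prop) (by fun_prop)
    · exact isClosed_iInter fun c => isClosed_iInter fun φ =>
        isClosed_eq (by fun_prop) (by fun_prop)
  have hb : {μ : C(X, ℝ) → ℝ | IsIdempotentProbability μ} ⊆
      Set.univ.pi fun φ : C(X, ℝ) => Set.Icc (-‖φ‖) ‖φ‖ := by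
    intro μ hμ φ _
    have h1 := mono ⟨μ, hμ⟩ (φ := ContinuousMap.const X (-‖φ‖)) (χ := φ)
      fun x => (abs_le.1 (φ.norm_coe_le_norm x)).1
    have h2 := mono ⟨μ, hμ⟩ (φ := φ) (χ := ContinuousMap.const X ‖φ‖)
      fun x => (abs_le.1 (φ.norm_coe_le_norm x)).2
    exact ⟨(hμ.map_const _).symm.le.trans h1, h2.trans (hμ.map_const _).le⟩
  exact isCompact_iff_compactSpace.1
    ((isCompact_univ_pi fun φ : C(X, ℝ) => isCompact_Icc).of_isClosed_subset hc hb)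

/-- The action of the functor on maps: `I(f)(μ)(φ) = μ(φ ∘ f)`. -/
def map (f : C(X, Y)) : C(IdempMeas X, IdempMeas Y) where
  toFun μ := ⟨fun φ => μ (φ.comp f),
    ⟨fun c => μ.2.map_const c, fun c φ => μ.2.map_add_const c (φ.comp f),
      fun φ χ => μ.2.map_sup (φ.comp f) (χ.comp f)⟩⟩
  continuous_toFun := continuous_of_apply fun φ => continuous_apply (φ.comp f)

/-- The unit `η_X(x) = δ_x`, where `δ_x(φ) = φ(x)`. -/
def unit (X : Type u) [TopologicalSpace X] : C(X, IdempMeas X) where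
  toFun x := ⟨fun φ => φ x,
    ⟨fun _ => rfl, fun c φ => add_comm c (φ x), fun _ _ => rfl⟩⟩
  continuous_toFun := continuous_of_apply fun φ => φ.continuous

/-- The function `φ̄ : I(X) → ℝ`, `φ̄(μ) = μ(φ)`. -/
def eval (φ : C(X, ℝ)) : C(IdempMeas X, ℝ) := ⟨fun μ => μ φ, continuous_apply φ⟩

/-- The multiplication `ψ_X : I²(X) → I(X)`, `ψ_X(M)(φ) = M(φ̄)`. -/
def mult (X : Type u) [TopologicalSpace X] : C(IdempMeas (IdempMeas X), IdempMeas X) where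
  toFun M := ⟨fun φ => M (eval φ), by
    refine ⟨fun c => ?_, fun c φ => ?_, fun φ χ => ?_⟩
    · refine Eq.trans ?_ (M.2.map_const c)
      refine congrArg M.1 (ContinuousMap.ext fun μ => ?_)
      exact μ.2.map_const c
    · rw [← M.2.map_add_const c]
      refine congrArg M.1 (ContinuousMap.ext fun μ => ?_)
      exact (μ.2.map_add_const c φ).trans (add_comm _ _)
    · rw [← M.2.map_sup]
      refine congrArg M.1 (ContinuousMap.ext fun μ => ?_)
      exact μ.2.map_sup φ χ⟩
  continuous_toFun := continuous_of_apply fun φ => continuous_apply (eval φ)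

/-! `(I, η, ψ)` is a monad. -/

theorem map_id (μ : IdempMeas X) : map (ContinuousMap.id X) μ = μ := rfl

theorem map_comp (g : C(Y, Z)) (f : C(X, Y)) (μ : IdempMeas X) :
    map (g.comp f) μ = map g (map f μ) := rfl

theorem map_unit (f : C(X, Y)) (x : X) : map f (unit X x) = unit Y (f x) := rfl

theorem map_mult (f : C(X, Y)) (M : IdempMeas (IdempMeas X)) :
    map f (mult X M) = mult Y (map (map f) M) := rfl

theorem mult_unit (μ : IdempMeas X) : mult X (unit (IdempMeas X) μ) = μ := rfl

theorem mult_map_unit (μ : IdempMeas X) : mult X (map (unit X) μ) = μ := rfl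

theorem mult_mult (M : IdempMeas (IdempMeas (IdempMeas X))) :
    mult X (map (mult X) M) = mult X (mult (IdempMeas X) M) := rfl

end IdempMeas

/-- A metric on the set `Y` that generates the given topology of `Y`. -/
structure CompatibleMetric (Y : Type u) [TopologicalSpace Y] where
  dist : Y → Y → ℝ
  dist_self : ∀ x, dist x x = 0
  dist_comm : ∀ x y, dist x y = dist y x
  dist_triangle : ∀ x y z, dist x z ≤ dist x y + dist y z
  eq_of_dist_eq_zero : ∀ x y, dist x y = 0 → x = y
  isOpen_iff : ∀ s : Set Y, IsOpen s ↔ ∀ x ∈ s, ∃ ε > 0, ∀ y, dist x y < ε → y ∈ s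

/-- The resulting Mathlib metric space; its topology is definitionally the given one. -/
abbrev CompatibleMetric.toMetricSpace {Y : Type u} [TopologicalSpace Y]
    (d : CompatibleMetric Y) : MetricSpace Y :=
  MetricSpace.ofDistTopology d.dist d.dist_self d.dist_comm d.dist_triangle d.isOpen_iff
    d.eq_of_dist_eq_zero

/-- A metric compactum `(X, ρ)`. -/
structure MetricCompactum : Type (u + 1) where
  carrier : Type u
  metric : MetricSpace carrier
  compact : CompactSpace carrier

namespace MetricCompactum

instance : CoeSort MetricCompactum.{u} (Type u) := ⟨MetricCompactum.carrier⟩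

instance (X : MetricCompactum.{u}) : MetricSpace X := X.metric

instance (X : MetricCompactum.{u}) : CompactSpace X := X.compact

end MetricCompactum

/-- An assignment, to every metric compactum `(X, ρ)`, of a metric `ρ_I` on `I(X)` that generates
the topology of `I(X)`. -/
def MetricLift : Type (u + 1) := ∀ X : MetricCompactum.{u}, CompatibleMetric (IdempMeas X)

namespace MetricLift

/-- The metric compactum `(I(X), ρ_I)`. -/
def obj (m : MetricLift.{u}) (X : MetricCompactum.{u}) : MetricCompactum.{u} where
  carrier := IdempMeas X
  metric := (m X).toMetricSpace
  compact := inferInstanceAs (CompactSpace (IdempMeas X))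

variable (m : MetricLift.{u})

/-- `I(f)` as a map between the metric compacta `(I(X), ρ_I)` and `(I(Y), ρ_I)`. -/
def map {X Y : MetricCompactum.{u}} (f : C(X, Y)) : C(m.obj X, m.obj Y) := IdempMeas.map f

/-- `η_X : (X, ρ) → (I(X), ρ_I)`. -/
def unit (X : MetricCompactum.{u}) : C(X, m.obj X) := IdempMeas.unit X

/-- `ψ_X : (I²(X), ρ_{I²}) → (I(X), ρ_I)`; here `ρ_{I²}` is the metric assigned to
`(I(X), ρ_I)`. -/
def mult (X : MetricCompactum.{u}) : C(m.obj (m.obj X), m.obj X) := IdempMeas.mult X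

/-- The iterates `(Iⁿ(X), ρ_{Iⁿ})`, with `I⁰(X) = X` and `Iⁿ⁺¹(X) = I(Iⁿ(X))`. -/
def iterObj (X : MetricCompactum.{u}) : ℕ → MetricCompactum.{u}
  | 0 => X
  | n + 1 => m.obj (iterObj X n)

/-- The iterates `Iⁿ(f) : Iⁿ(X) → Iⁿ(Y)`. -/
def iterMap {X Y : MetricCompactum.{u}} (f : C(X, Y)) :
    ∀ n : ℕ, C(m.iterObj X n, m.iterObj Y n)
  | 0 => f
  | n + 1 => m.map (iterMap f n)

/-- The assignment `ρ ↦ ρ_I` is a metrization of the functor `I`. -/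
structure IsMetrization : Prop where
  isometry_map : ∀ {X Y : MetricCompactum.{u}} (f : C(X, Y)), Isometry f → Isometry (m.map f)
  isometry_unit : ∀ X : MetricCompactum.{u}, Isometry (m.unit X)
  diam_eq : ∀ X : MetricCompactum.{u},
    Metric.diam (Set.univ : Set (m.obj X)) = Metric.diam (Set.univ : Set X)

/-- The metrization is uniform: for every continuous `f : X → Y` the iterates `Iⁿ(f)` are uniformly
continuous, uniformly in `n`. As the unit maps `Iⁿ(X) → Iⁿ⁺¹(X)` are isometric embeddings that
commute with the maps `Iⁿ(f)`, this says that the map induced by `f` between the unions of the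
towers `X ⊆ I(X) ⊆ I²(X) ⊆ ⋯` and `Y ⊆ I(Y) ⊆ I²(Y) ⊆ ⋯` is uniformly continuous. -/
structure IsUniformMetrization : Prop extends IsMetrization m where
  uniform_iterMap : ∀ {X Y : MetricCompactum.{u}} (f : C(X, Y)), ∀ ε > 0, ∃ δ > 0,
    ∀ (n : ℕ) (a b : m.iterObj X n), dist a b < δ → dist (m.iterMap f n a) (m.iterMap f n b) < ε

/-- The metrization is perfect: it is uniform and compatible with the monad structure. -/
structure IsPerfectMetrization : Prop extends IsUniformMetrization m where
  mult_nonexpanding : ∀ (X : MetricCompactum.{u}) (M N : m.obj (m.obj X)),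
    dist (m.mult X M) (m.mult X N) ≤ dist M N
  dist_unit_eq : ∀ (X : MetricCompactum.{u}) (μ : m.obj X) (x₀ : X) (N : m.obj (m.obj X)),
    m.mult X N = μ → dist μ (m.unit X x₀) = dist (m.unit (m.obj X) (m.unit X x₀)) N
  le_infDist_unit : ∀ (X : MetricCompactum.{u}) (μ : m.obj X) (ε : ℝ),
    ε ≤ Metric.infDist μ (Set.range (m.unit X)) →
      ε ≤ Metric.infDist (m.map (m.unit X) μ) (Set.range (m.unit (m.obj X)))

end MetricLift

/-! Heuristically an idempotent measure is `φ ↦ max (φ + m)` for a density `m ≤ 0` with maximum 0.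
The distance is of Prokhorov type: it is the infimum of the sizes `s` for which each density lies
below the other one spread out by the kernel, `m x ≤ sup_y (n y + kernel s (dist x y))`. `Dominated`
expresses this through test functions, so densities are never needed.

All the axioms come from properties of `kernel s d`, for `s > 0` and `d ≥ 0`. Superadditivity in
`(s, d)` gives the triangle inequality. Nonnegativity exactly for `d ≤ s` gives the isometry of `η`
and the diameter. The limit `-∞` as `s → 0` with `d > 0` fixed makes evaluations continuous, and
compactness makes finitely many evaluations control the distance. The inequality `kernel s q +
kernel q d ≤ kernel s d` makes `ψ` non-expanding; its equality case `s ≤ q ≤ d`, together with the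
fact that the distance to a point mass is read off a single test function `cone`, gives condition 6.
Condition 7 follows by replacing a measure by a point of full density.

Uniformity explains the logarithm. Put `V d = d + log d`; then `kernel s d = V s - V d` for `d ≥ s`,
which is unchanged when `V` is shifted by a constant. Hence moduli of continuity of the form `V t =
V s + c`, up to an additive `ε`, pass from `f` to `I(f)` with the same `ε` and `c`, and so to every
iterate. -/

/-! ### The kernel -/

namespace IdempMeas

/-- The kernel `s - d - log⁺ (d / s)`. It is nonnegative exactly for `d ≤ s`. -/
noncomputable def kernel (s d : ℝ) : ℝ := s - d - Real.posLog (d / s)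

theorem continuous_kernel (s : ℝ) : Continuous (kernel s) := by
  unfold kernel
  have := Real.continuous_posLog
  fun_prop

theorem kernel_zero (s : ℝ) : kernel s 0 = s := by simp [kernel]

theorem kernel_of_le {s d : ℝ} (hd : 0 ≤ d) (h : d ≤ s) : kernel s d = s - d := by
  have : Real.posLog (d / s) = 0 := by
    rw [Real.posLog_eq_zero_iff, abs_of_nonneg (div_nonneg hd (hd.trans h))]
    exact div_le_one_of_le₀ h (hd.trans h)
  simp [kernel, this]

theorem kernel_of_ge {s d : ℝ} (hs : 0 < s) (h : s ≤ d) :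
    kernel s d = s + Real.log s - (d + Real.log d) := by
  have h1 : 1 ≤ d / s := (one_le_div hs).2 h
  have : Real.posLog (d / s) = Real.log d - Real.log s := by
    rw [Real.posLog_eq_log (h1.trans (le_abs_self _)), Real.log_div (hs.trans_le h).ne' hs.ne']
  rw [kernel, this]
  ring

theorem kernel_le_sub (s d : ℝ) : kernel s d ≤ s - d :=
  sub_le_self _ Real.posLog_nonneg

theorem kernel_le {s d : ℝ} (hd : 0 ≤ d) : kernel s d ≤ s :=
  (kernel_le_sub s d).trans (sub_le_self _ hd)

theorem kernel_anti {s d d' : ℝ} (hs : 0 < s) (hd : 0 ≤ d) (h : d ≤ d') :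
    kernel s d' ≤ kernel s d := by
  have := Real.posLog_le_posLog (div_nonneg hd hs.le) (div_le_div_of_nonneg_right h hs.le)
  unfold kernel
  linarith

theorem kernel_add_le {s d r : ℝ} (hs : 0 < s) (hd : 0 ≤ d) (hr : 0 ≤ r) :
    kernel s d + r ≤ kernel (s + r) d := by
  have := Real.posLog_le_posLog (div_nonneg hd (add_nonneg hs.le hr))
    (div_le_div_of_nonneg_left hd hs (le_add_of_nonneg_right hr))
  unfold kernel
  linarith

theorem kernel_mono {s t d : ℝ} (hs : 0 < s) (hd : 0 ≤ d) (h : s ≤ t) :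
    kernel s d ≤ kernel t d := by
  have := kernel_add_le hs hd (sub_nonneg.2 h)
  rw [add_sub_cancel] at this
  linarith

/-- The quotient `(d + e) / (s + t)` is a weighted mean of `d / s` and `e / t`, hence at most their
maximum. This is the source of the triangle inequality. -/
theorem kernel_add_kernel_le {s t d e : ℝ} (hs : 0 < s) (ht : 0 < t) (hd : 0 ≤ d) (he : 0 ≤ e) :
    kernel s d + kernel t e ≤ kernel (s + t) (d + e) := by
  have key : (d + e) / (s + t) ≤ max (d / s) (e / t) := by
    rw [div_le_iff₀ (add_pos hs ht), mul_add]
    exact add_le_add ((div_le_iff₀ hs).1 (le_max_left _ _)) ((div_le_iff₀ ht).1 (le_max_right _ _))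
  have h1 := Real.posLog_le_posLog (div_nonneg (add_nonneg hd he) (add_pos hs ht).le) key
  have h2 : Real.posLog (max (d / s) (e / t)) ≤ Real.posLog (d / s) + Real.posLog (e / t) := by
    rcases max_cases (d / s) (e / t) with h | h <;> rw [h.1]
    · exact le_add_of_nonneg_right Real.posLog_nonneg
    · exact le_add_of_nonneg_left Real.posLog_nonneg
  unfold kernel
  linarith

/-- Superadditivity with `kernel r r = 0`; it absorbs a slack `r` in both arguments. -/
theorem kernel_le_kernel_add {s d r : ℝ} (hs : 0 < s) (hd : 0 ≤ d) (hr : 0 < r) :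
    kernel s d ≤ kernel (s + r) (d + r) := by
  have := kernel_add_kernel_le hs hr hd hr.le
  rwa [kernel_of_le hr.le le_rfl, sub_self, add_zero] at this

/-- The linear parts telescope, and `log⁺ (a b) ≤ log⁺ a + log⁺ b`. -/
theorem kernel_comp_le {s q d : ℝ} (hq : 0 < q) :
    kernel s q + kernel q d ≤ kernel s d := by
  have := Real.posLog_mul (x := d / q) (y := q / s)
  rw [div_mul_div_cancel₀ hq.ne'] at this
  unfold kernel
  linarith

theorem kernel_comp_eq {s q d : ℝ} (hs : 0 < s) (hsq : s ≤ q) (hqd : q ≤ d) :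
    kernel s q + kernel q d = kernel s d := by
  rw [kernel_of_ge hs hsq, kernel_of_ge (hs.trans_le hsq) hqd, kernel_of_ge hs (hsq.trans hqd)]
  ring

theorem exists_kernel_le {δ : ℝ} (hδ : 0 < δ) (ε K : ℝ) (hε : 0 < ε) :
    ∃ s, 0 < s ∧ s ≤ ε ∧ ∀ d, δ ≤ d → kernel s d ≤ -K := by
  -- The bound `s ≤ δ` puts `δ` on the logarithmic branch of the kernel, and `s ≤ δ exp (-K)` gives
  -- `log s - log δ ≤ -K`.
  refine ⟨min ε (min δ (δ * Real.exp (-K))), by positivity, min_le_left _ _, fun d hd => ?_⟩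
  set s := min ε (min δ (δ * Real.exp (-K))) with hs
  have hs0 : 0 < s := by positivity
  have h1 : s ≤ δ := (min_le_right _ _).trans (min_le_left _ _)
  have h2 : s ≤ δ * Real.exp (-K) := (min_le_right _ _).trans (min_le_right _ _)
  have h3 := Real.log_le_log hs0 h2
  rw [Real.log_mul hδ.ne' (Real.exp_pos _).ne', Real.log_exp] at h3
  have h4 := kernel_anti hs0 hδ.le hd
  rw [kernel_of_ge hs0 h1] at h4
  linarith

/-! ### Elementary properties of idempotent measures -/

section Basic

variable {X : Type*} [TopologicalSpace X]

theorem apply_add_const (μ : IdempMeas X) (φ : C(X, ℝ)) (c : ℝ) :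
    μ (φ + ContinuousMap.const X c) = μ φ + c := by
  rw [add_comm]
  exact μ.2.map_add_const c φ

theorem apply_mono (μ : IdempMeas X) {φ χ : C(X, ℝ)} (h : ∀ x, φ x ≤ χ x) : μ φ ≤ μ χ :=
  μ.mono h

theorem apply_le_const (μ : IdempMeas X) {φ : C(X, ℝ)} {c : ℝ} (h : ∀ x, φ x ≤ c) : μ φ ≤ c :=
  (μ.mono (χ := ContinuousMap.const X c) h).trans (μ.2.map_const c).le

theorem const_le_apply (μ : IdempMeas X) {φ : C(X, ℝ)} {c : ℝ} (h : ∀ x, c ≤ φ x) : c ≤ μ φ :=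
  (μ.2.map_const c).symm.le.trans (μ.mono (φ := ContinuousMap.const X c) h)

theorem apply_le_add (μ : IdempMeas X) {φ χ : C(X, ℝ)} {c : ℝ} (h : ∀ x, φ x ≤ χ x + c) :
    μ φ ≤ μ χ + c :=
  (μ.mono (χ := χ + ContinuousMap.const X c) h).trans (μ.apply_add_const χ c).le

theorem apply_sup' (μ : IdempMeas X) {ι : Type*} (t : Finset ι) (ht : t.Nonempty)
    (f : ι → C(X, ℝ)) : μ (t.sup' ht f) = t.sup' ht fun i => μ (f i) :=
  Finset.apply_sup'_eq_sup'_comp ht μ.1 μ.2.map_sup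

theorem nonempty (μ : IdempMeas X) : Nonempty X := by
  by_contra h
  rw [not_nonempty_iff] at h
  have h0 := μ.2.map_const 0
  have h1 := μ.2.map_const 1
  rw [Subsingleton.elim (ContinuousMap.const X (1 : ℝ)) (ContinuousMap.const X 0), h0] at h1
  exact zero_ne_one h1

/-- An idempotent measure on a compact space has a point of full density. -/
theorem exists_apply_le [CompactSpace X] (μ : IdempMeas X) : ∃ y, ∀ φ : C(X, ℝ), φ y ≤ μ φ := by
  by_contra! h
  choose φ hφ using h
  have := μ.nonempty
  obtain ⟨t, ht⟩ := isCompact_univ.elim_finite_subcover (fun y => {x | μ (φ y) < φ y x})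
    (fun y => isOpen_lt continuous_const (φ y).continuous)
    (fun y _ => Set.mem_iUnion.2 ⟨y, hφ y⟩)
  have hcov : ∀ x, ∃ y ∈ t, μ (φ y) < φ y x := fun x => by simpa using ht (Set.mem_univ x)
  have htn : t.Nonempty := by
    obtain ⟨y, hy, -⟩ := hcov (Classical.arbitrary X)
    exact ⟨y, hy⟩
  -- After normalisation each `ψ y` has measure 0, hence so has the finite supremum `Ψ`. But `Ψ` is
  -- positive everywhere, so its minimum is a positive lower bound for its measure.
  let ψ : X → C(X, ℝ) := fun y => φ y + ContinuousMap.const X (-μ (φ y))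
  let Ψ := t.sup' htn ψ
  have h0 : μ Ψ = 0 := by
    refine (μ.apply_sup' t htn ψ).trans ?_
    have : (fun y => μ (ψ y)) = fun _ => (0 : ℝ) := by
      funext y
      simp only [ψ, apply_add_const, add_neg_cancel]
    rw [this]
    exact Finset.sup'_const htn 0
  obtain ⟨x₀, -, hx₀⟩ := isCompact_univ.exists_isMinOn Set.univ_nonempty Ψ.continuous.continuousOn
  have hpos : ∀ x, 0 < Ψ x := by
    intro x
    obtain ⟨y, hy, hxy⟩ := hcov x
    have h1 : ψ y ≤ Ψ := Finset.le_sup' ψ hy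
    have h2 : ψ y x ≤ Ψ x := h1 x
    have h3 : ψ y x = φ y x + -μ (φ y) := rfl
    linarith
  have := μ.const_le_apply (φ := Ψ) (c := Ψ x₀) fun x => hx₀ (Set.mem_univ x)
  linarith [hpos x₀]

end Basic

/-! ### Dilation -/

section Dilate

variable {X Y : Type u} [TopologicalSpace X] [CompactSpace X] [MetricSpace Y]

/-- The function `y ↦ sup_x (φ x + kernel s (dist (i x) y))`. -/
noncomputable def dilate (i : C(X, Y)) (s : ℝ) (φ : C(X, ℝ)) : C(Y, ℝ) where
  toFun y := sSup ((fun x => φ x + kernel s (dist (i x) y)) '' Set.univ)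
  continuous_toFun := by
    refine isCompact_univ.continuous_sSup (f := fun y x => φ x + kernel s (dist (i x) y)) ?_
    have := continuous_kernel s
    exact (φ.continuous.comp continuous_snd).add
      (this.comp ((i.continuous.comp continuous_snd).dist continuous_fst))

theorem le_dilate (i : C(X, Y)) (s : ℝ) (φ : C(X, ℝ)) (x : X) (y : Y) :
    φ x + kernel s (dist (i x) y) ≤ dilate i s φ y := by
  refine le_csSup (isCompact_univ.image ?_).bddAbove ⟨x, Set.mem_univ x, rfl⟩
  exact φ.continuous.add ((continuous_kernel s).comp (i.continuous.dist continuous_const))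

theorem dilate_le [Nonempty X] {i : C(X, Y)} {s : ℝ} {φ : C(X, ℝ)} {y : Y} {c : ℝ}
    (h : ∀ x, φ x + kernel s (dist (i x) y) ≤ c) : dilate i s φ y ≤ c := by
  refine csSup_le (Set.univ_nonempty.image _) ?_
  rintro _ ⟨x, -, rfl⟩
  exact h x

end Dilate

/-! ### The distance -/

section Dist

variable {X Y : Type u} [MetricSpace X] [CompactSpace X] [MetricSpace Y] [CompactSpace Y]

/-- `μ` is dominated by `ν` after dilation of size `s`. -/
def Dominated (s : ℝ) (μ ν : IdempMeas X) : Prop :=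
  ∀ φ : C(X, ℝ), μ φ ≤ ν (dilate (ContinuousMap.id X) s φ)

theorem Dominated.mono {s t : ℝ} {μ ν : IdempMeas X} (hs : 0 < s) (hst : s ≤ t)
    (h : Dominated s μ ν) : Dominated t μ ν := fun φ => by
  have := μ.nonempty
  refine (h φ).trans (ν.apply_mono fun y => dilate_le fun x => ?_)
  exact (add_le_add_right (kernel_mono hs dist_nonneg hst) _).trans (le_dilate _ t φ x y)

theorem Dominated.refl {s : ℝ} (hs : 0 < s) (μ : IdempMeas X) : Dominated s μ μ := fun φ =>
  μ.apply_mono fun y => by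
    have := le_dilate (ContinuousMap.id X) s φ y y
    rw [ContinuousMap.id_apply, dist_self, kernel_zero] at this
    linarith

theorem Dominated.trans {s t : ℝ} {μ ν κ : IdempMeas X} (hs : 0 < s) (ht : 0 < t)
    (h : Dominated s μ ν) (h' : Dominated t ν κ) : Dominated (s + t) μ κ := fun φ => by
  have := μ.nonempty
  refine ((h φ).trans (h' _)).trans (κ.apply_mono fun z => dilate_le fun y => ?_)
  rw [← le_sub_iff_add_le]
  refine dilate_le fun x => ?_
  rw [le_sub_iff_add_le, add_assoc]
  refine le_trans (add_le_add_right ?_ _) (le_dilate _ (s + t) φ x z)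
  exact (kernel_add_kernel_le hs ht dist_nonneg dist_nonneg).trans
    (kernel_anti (add_pos hs ht) dist_nonneg (dist_triangle _ _ _))

/-- Any pointwise comparison of kernels along `f` passes to measures; isometries and moduli of
continuity are both treated this way. -/
theorem Dominated.map {s t : ℝ} {μ ν : IdempMeas X} (f : C(X, Y))
    (hf : ∀ x y, kernel s (dist x y) ≤ kernel t (dist (f x) (f y))) (h : Dominated s μ ν) :
    Dominated t (map f μ) (map f ν) := fun φ => by
  have := μ.nonempty
  refine (h (φ.comp f)).trans (ν.apply_mono fun y => dilate_le fun x => ?_)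
  exact (add_le_add_right (hf x y) _).trans (le_dilate (ContinuousMap.id Y) t φ (f x) (f y))

/-- A test function on `X` has to be extended to `Y`. Its dilation `dilate f r φ` along `f` does
this, majorising `φ` on `X` at the cost of `r`. -/
theorem Dominated.of_map {s r : ℝ} {μ ν : IdempMeas X} {f : C(X, Y)} (hf : Isometry f)
    (hs : 0 < s) (hr : 0 < r) (h : Dominated s (IdempMeas.map f μ) (IdempMeas.map f ν)) :
    Dominated (s + r) μ ν := fun φ => by
  have := μ.nonempty
  have : Nonempty Y := this.map f
  have h1 : μ φ ≤ μ ((dilate f r φ).comp f) := μ.apply_mono fun x => by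
    have := le_dilate f r φ x (f x)
    rw [dist_self, kernel_zero] at this
    exact (le_add_of_nonneg_right hr.le).trans this
  refine (h1.trans (h (dilate f r φ))).trans (ν.apply_mono fun y => dilate_le fun z => ?_)
  rw [← le_sub_iff_add_le]
  refine dilate_le fun x => ?_
  rw [le_sub_iff_add_le, add_assoc]
  refine le_trans (add_le_add_right ?_ _) (le_dilate _ (s + r) φ x y)
  rw [ContinuousMap.id_apply, ContinuousMap.id_apply, ← hf.dist_eq x y, add_comm s r]
  exact (kernel_add_kernel_le hr hs dist_nonneg dist_nonneg).trans
    (kernel_anti (add_pos hr hs) dist_nonneg (dist_triangle _ _ _))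

theorem dominated_of_forall_dist_le {s : ℝ} (h : ∀ x y : X, dist x y ≤ s) (μ ν : IdempMeas X) :
    Dominated s μ ν := fun φ => by
  have := μ.nonempty
  obtain ⟨x, -, hx⟩ := isCompact_univ.exists_isMaxOn Set.univ_nonempty φ.continuous.continuousOn
  refine (μ.apply_le_const fun y => hx (Set.mem_univ y)).trans (ν.const_le_apply fun y => ?_)
  have := le_dilate (ContinuousMap.id X) s φ x y
  rw [ContinuousMap.id_apply, kernel_of_le dist_nonneg (h x y)] at this
  linarith [h x y]

/-- The distance between idempotent measures: the infimum of the sizes of dilations after which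
each measure dominates the other. -/
noncomputable def idist (μ ν : IdempMeas X) : ℝ :=
  sInf {s | 0 < s ∧ Dominated s μ ν ∧ Dominated s ν μ}

theorem idist_nonneg (μ ν : IdempMeas X) : 0 ≤ idist μ ν :=
  Real.sInf_nonneg fun _ h => h.1.le

theorem idist_comm (μ ν : IdempMeas X) : idist μ ν = idist ν μ := by
  simp only [idist, and_comm (a := Dominated _ μ ν)]

theorem idist_le {s : ℝ} {μ ν : IdempMeas X} (hs : 0 < s) (h : Dominated s μ ν)
    (h' : Dominated s ν μ) : idist μ ν ≤ s :=
  csInf_le ⟨0, fun _ h => h.1.le⟩ ⟨hs, h, h'⟩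

theorem dominated_of_idist_lt {s : ℝ} {μ ν : IdempMeas X} (h : idist μ ν < s) :
    Dominated s μ ν := by
  have hne : {s | 0 < s ∧ Dominated s μ ν ∧ Dominated s ν μ}.Nonempty := by
    refine ⟨Metric.diam (Set.univ : Set X) + 1, by positivity, ?_, ?_⟩ <;>
    · refine dominated_of_forall_dist_le (fun x y => ?_) _ _
      have := Metric.dist_le_diam_of_mem isCompact_univ.isBounded (Set.mem_univ x) (Set.mem_univ y)
      linarith
  obtain ⟨t, ⟨ht, h1, -⟩, hts⟩ := exists_lt_of_csInf_lt hne h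
  exact h1.mono ht hts.le

theorem idist_le_of_forall {a : ℝ} {μ ν : IdempMeas X} (ha : 0 ≤ a)
    (h : ∀ s, a < s → Dominated s μ ν ∧ Dominated s ν μ) : idist μ ν ≤ a :=
  le_of_forall_gt_imp_ge_of_dense fun s hs => idist_le (ha.trans_lt hs) (h s hs).1 (h s hs).2

theorem idist_self (μ : IdempMeas X) : idist μ μ = 0 :=
  le_antisymm (idist_le_of_forall le_rfl fun _ hs => ⟨.refl hs μ, .refl hs μ⟩) (idist_nonneg μ μ)

theorem idist_triangle (μ ν κ : IdempMeas X) : idist μ κ ≤ idist μ ν + idist ν κ := by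
  refine idist_le_of_forall (add_nonneg (idist_nonneg _ _) (idist_nonneg _ _)) fun s hs => ?_
  set r := (s - (idist μ ν + idist ν κ)) / 2 with hr
  have hr0 : 0 < r := by linarith
  have e : s = (idist μ ν + r) + (idist ν κ + r) := by linarith
  have h1 := idist_nonneg μ ν
  have h2 := idist_nonneg ν κ
  constructor
  · rw [e]
    exact (dominated_of_idist_lt (by linarith)).trans (by linarith) (by linarith)
      (dominated_of_idist_lt (by linarith))
  · rw [e, add_comm]
    rw [idist_comm μ ν, idist_comm ν κ] at *
    exact (dominated_of_idist_lt (by linarith)).trans (by linarith) (by linarith)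
      (dominated_of_idist_lt (by linarith))

/-! ### The distance generates the topology of pointwise convergence -/

/-- Evaluations are continuous with respect to the distance. -/
theorem exists_apply_le_of_idist_lt (φ : C(X, ℝ)) {ε : ℝ} (hε : 0 < ε) :
    ∃ s > 0, ∀ μ ν : IdempMeas X, idist μ ν < s → μ φ ≤ ν φ + ε := by
  have huc := CompactSpace.uniformContinuous_of_continuous φ.continuous
  obtain ⟨δ, hδ, hφ⟩ := Metric.uniformContinuous_iff.1 huc (ε / 2) (half_pos hε)
  -- Points nearer than `δ` cost `ε / 2` for the oscillation of `φ` and `s ≤ ε / 2` for the kernel.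
  -- At farther points the penalty `2 * ‖φ‖` outweighs any difference of values of `φ`.
  obtain ⟨s, hs, hsε, hk⟩ := exists_kernel_le hδ (ε / 2) (2 * ‖φ‖) (half_pos hε)
  refine ⟨s, hs, fun μ ν h => ?_⟩
  have := μ.nonempty
  refine (dominated_of_idist_lt h φ).trans (ν.apply_le_add fun y => dilate_le fun x => ?_)
  rcases lt_or_ge (dist x y) δ with hxy | hxy
  · have h1 := hφ hxy
    rw [Real.dist_eq, abs_lt] at h1
    have h2 := kernel_le (s := s) (dist_nonneg (x := x) (y := y))
    simp only [ContinuousMap.id_apply]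
    linarith
  · have h1 := hk _ hxy
    have h2 := abs_le.1 (φ.norm_coe_le_norm x)
    have h3 := abs_le.1 (φ.norm_coe_le_norm y)
    simp only [ContinuousMap.id_apply]
    linarith

theorem eq_of_idist_eq_zero {μ ν : IdempMeas X} (h : idist μ ν = 0) : μ = ν := by
  refine ext_apply fun φ => le_antisymm ?_ ?_ <;> refine le_of_forall_pos_le_add fun ε hε => ?_
  all_goals obtain ⟨s, hs, hφ⟩ := exists_apply_le_of_idist_lt φ hε
  · exact hφ _ _ (h.trans_lt hs)
  · exact hφ _ _ ((idist_comm _ _).trans_lt (h.trans_lt hs))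

/-- A dilation is controlled by finitely many evaluations. -/
theorem dominated_of_net {r : ℝ} (hr : 0 < r) {t : Finset X} (ht : ∀ y : X, ∃ x ∈ t, dist x y ≤ r)
    {b : X → C(X, ℝ)} (hb : ∀ x y, b x y = kernel r (dist x y)) {μ ν : IdempMeas X}
    (h : ∀ x ∈ t, μ (b x) ≤ ν (b x) + r) : Dominated (r + r + r) μ ν := fun φ => by
  have := μ.nonempty
  have htn : t.Nonempty := by
    obtain ⟨x, hx, -⟩ := ht (Classical.arbitrary X)
    exact ⟨x, hx⟩
  -- On the ball about a net point `x` the function `φ` is replaced by its maximum, attained at `z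
  -- x`. The bumps `b x` raised by these maxima then majorise `φ`.
  have hex : ∀ x : X, ∃ z, dist z x ≤ r ∧ ∀ y, dist x y ≤ r → φ y ≤ φ z := by
    intro x
    obtain ⟨z, hz, hmax⟩ := (isCompact_closedBall x r).exists_isMaxOn
      ⟨x, Metric.mem_closedBall_self hr.le⟩ φ.continuous.continuousOn
    refine ⟨z, hz, fun y hy => hmax ?_⟩
    rwa [Metric.mem_closedBall, dist_comm]
  choose z hz hmax using hex
  let f : X → C(X, ℝ) := fun x => b x + ContinuousMap.const X (φ (z x))
  have hfx : ∀ x y, f x y = kernel r (dist x y) + φ (z x) := fun x y => by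
    rw [← hb]
    rfl
  have h1 : φ ≤ t.sup' htn f := by
    intro y
    obtain ⟨x, hx, hxy⟩ := ht y
    have h2 : f x ≤ t.sup' htn f := Finset.le_sup' f hx
    refine le_trans ?_ (h2 y)
    change φ y ≤ f x y
    rw [hfx, kernel_of_le dist_nonneg hxy]
    linarith [hmax x y hxy]
  refine (μ.mono h1).trans ?_
  rw [apply_sup']
  refine Finset.sup'_le _ _ fun x hx => ?_
  have h3 : μ (f x) ≤ ν (f x) + r := by
    simp only [f, apply_add_const]
    linarith [h x hx]
  rw [← apply_add_const] at h3
  refine h3.trans (ν.apply_mono fun y => ?_)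
  refine le_trans ?_ (le_dilate _ _ φ (z x) y)
  -- The three copies of `r` are the size of the bump, the move of its centre from `x` to `z x`, and
  -- the error allowed in `h`.
  have h4 : dist (z x) y ≤ dist x y + r := by
    linarith [dist_triangle (z x) x y, hz x]
  have h5 := kernel_anti (s := r + r + r) (by linarith) dist_nonneg h4
  have h6 := kernel_le_kernel_add hr (dist_nonneg (x := x) (y := y)) hr
  have h7 := kernel_add_le (s := r + r) (d := dist x y + r) (by linarith) (by positivity) hr.le
  have h8 : (f x + ContinuousMap.const X r) y = f x y + r := rfl
  rw [h8, hfx, ContinuousMap.id_apply]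
  linarith

theorem eventually_idist_lt (μ : IdempMeas X) {ε : ℝ} (hε : 0 < ε) :
    ∀ᶠ ν in nhds μ, idist μ ν < ε := by
  set r := ε / 4 with hr
  have hr0 : 0 < r := by positivity
  obtain ⟨t, ht⟩ := isCompact_univ.elim_finite_subcover (fun x : X => Metric.ball x r)
    (fun x => Metric.isOpen_ball) fun x _ => Set.mem_iUnion.2 ⟨x, Metric.mem_ball_self hr0⟩
  have hcov : ∀ y : X, ∃ x ∈ t, dist x y ≤ r := fun y => by
    obtain ⟨x, hx, hxy⟩ : ∃ x ∈ t, dist y x < r := by simpa using ht (Set.mem_univ y)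
    exact ⟨x, hx, dist_comm y x ▸ hxy.le⟩
  let b : X → C(X, ℝ) := fun x =>
    ⟨fun y => kernel r (dist x y), (continuous_kernel r).comp (continuous_const.dist continuous_id)⟩
  have hev : ∀ᶠ ν in nhds μ, ∀ x ∈ t, dist (ν (b x)) (μ (b x)) < r := by
    rw [Filter.eventually_all_finset]
    exact fun x _ => (continuous_apply (b x)).continuousAt.eventually
      (Metric.ball_mem_nhds _ hr0)
  filter_upwards [hev] with ν hν
  have h1 : ∀ x ∈ t, |ν (b x) - μ (b x)| < r := hν
  have hlt : r + r + r < ε := by linarith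
  refine lt_of_le_of_lt (idist_le (by positivity) ?_ ?_) hlt
  · exact dominated_of_net hr0 hcov (fun _ _ => rfl) fun x hx => by
      linarith [(abs_lt.1 (h1 x hx)).1]
  · exact dominated_of_net hr0 hcov (fun _ _ => rfl) fun x hx => by
      linarith [(abs_lt.1 (h1 x hx)).2]

theorem isOpen_iff_idist (s : Set (IdempMeas X)) :
    IsOpen s ↔ ∀ μ ∈ s, ∃ ε > 0, ∀ ν, idist μ ν < ε → ν ∈ s := by
  constructor
  · intro hs μ hμ
    by_contra! hcon
    obtain ⟨U, hU, rfl⟩ := isOpen_induced_iff.1 hs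
    rw [isOpen_pi_iff] at hU
    obtain ⟨F, u, hu, hsub⟩ := hU μ.1 hμ
    have hF : ∀ φ ∈ F, ∃ δ > 0, ∀ ν : IdempMeas X, idist μ ν < δ → ν φ ∈ u φ := by
      intro φ hφ
      obtain ⟨ε, hε, hball⟩ := Metric.isOpen_iff.1 (hu φ hφ).1 _ (hu φ hφ).2
      obtain ⟨δ, hδ, h⟩ := exists_apply_le_of_idist_lt φ (half_pos hε)
      refine ⟨δ, hδ, fun ν hν => hball ?_⟩
      have h1 := h μ ν hν
      have h2 := h ν μ ((idist_comm _ _).trans_lt hν)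
      rw [Metric.mem_ball, Real.dist_eq, abs_lt]
      constructor <;> linarith
    choose! δ hδ h using hF
    obtain ⟨ε, hε, hεδ⟩ : ∃ ε > 0, ∀ φ ∈ F, ε ≤ δ φ := by
      rcases F.eq_empty_or_nonempty with rfl | hne
      · exact ⟨1, one_pos, by simp⟩
      · exact ⟨F.inf' hne δ, (Finset.lt_inf'_iff hne).2 hδ, fun φ hφ => Finset.inf'_le δ hφ⟩
    obtain ⟨ν, hν, hνs⟩ := hcon ε hε
    exact hνs (hsub fun φ hφ => h φ hφ ν (hν.trans_le (hεδ φ hφ)))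
  · intro h
    refine isOpen_iff_mem_nhds.2 fun μ hμ => ?_
    obtain ⟨ε, hε, hs⟩ := h μ hμ
    exact (eventually_idist_lt μ hε).mono hs

/-- The distance `idist` as a metric generating the topology of pointwise convergence. -/
noncomputable def compatibleMetric (X : Type u) [MetricSpace X] [CompactSpace X] :
    CompatibleMetric (IdempMeas X) where
  dist := idist
  dist_self := idist_self
  dist_comm := idist_comm
  dist_triangle := idist_triangle
  eq_of_dist_eq_zero _ _ := eq_of_idist_eq_zero
  isOpen_iff := isOpen_iff_idist

end Dist

section Metric

variable {X Y : Type u} [MetricSpace X] [MetricSpace Y]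

/-! ### Moduli of continuity preserved by the functor -/

/-- `f` has modulus of continuity `s ↦ ε + t`, where `t + log t = s + log s + c`. -/
def HasLogModulus (ε c : ℝ) (f : X → Y) : Prop :=
  ∀ s t : ℝ, 0 < s → 0 < t → t + Real.log t = s + Real.log s + c →
    ∀ x y, dist x y < s → dist (f x) (f y) ≤ ε + t

theorem exists_add_log_eq (v : ℝ) : ∃ s, 0 < s ∧ s + Real.log s = v := by
  -- At `exp (-|v| - 1)` the function is at most `-|v|`, and at `1 + |v|` it is at least `1 + |v|`.
  have ha : Real.exp (-|v| - 1) ≤ 1 := Real.exp_le_one_iff.2 (by linarith [abs_nonneg v])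
  have hb : (1 : ℝ) ≤ 1 + |v| := by linarith [abs_nonneg v]
  have hcont : ContinuousOn (fun s : ℝ => s + Real.log s)
      (Set.Icc (Real.exp (-|v| - 1)) (1 + |v|)) :=
    continuousOn_id.add (Real.continuousOn_log.mono fun s hs =>
      ((Real.exp_pos _).trans_le hs.1).ne')
  obtain ⟨s, hs, hsv⟩ := intermediate_value_Icc (ha.trans hb) hcont (show v ∈ _ by
    constructor
    · change _ + Real.log _ ≤ v
      rw [Real.log_exp]
      linarith [neg_abs_le v]
    · linarith [le_abs_self v, Real.log_nonneg hb])
  exact ⟨s, (Real.exp_pos _).trans_le hs.1, hsv⟩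

theorem le_of_add_log_le {s t : ℝ} (ht : 0 < t) (h : s + Real.log s ≤ t + Real.log t) :
    s ≤ t := by
  by_contra! hlt
  linarith [Real.log_lt_log ht hlt]

/-- For `s ≤ d` both kernels are differences of values of `V x = x + log x`, and the shift `c`
cancels. For `d ≤ s` the claim is `s - d ≤ t - e`: a shift of `V` upwards expands distances, since
the slope `1 + 1 / x` of `V` decreases. -/
theorem kernel_le_kernel_of_add_log_eq {s t d e c : ℝ} (hs : 0 < s) (ht : 0 < t) (hd : 0 < d)
    (he : 0 < e) (hc : 0 ≤ c) (hst : t + Real.log t = s + Real.log s + c)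
    (hde : e + Real.log e = d + Real.log d + c) : kernel s d ≤ kernel t e := by
  rcases le_total s d with h | h
  · have hte : t ≤ e := le_of_add_log_le he (by linarith [Real.log_le_log hs h])
    rw [kernel_of_ge hs h, kernel_of_ge ht hte]
    linarith
  · have hle := Real.log_le_log hd h
    have hte : e ≤ t := le_of_add_log_le ht (by linarith)
    rw [kernel_of_le hd.le h, kernel_of_le he.le hte]
    have hde' : d ≤ e := le_of_add_log_le he (by linarith)
    by_contra! hlt
    have h1 : Real.log s - Real.log d < Real.log t - Real.log e := by linarith
    rw [← Real.log_div hs.ne' hd.ne', ← Real.log_div ht.ne' he.ne'] at h1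
    have h2 := (Real.log_lt_log_iff (div_pos hs hd) (div_pos ht he)).1 h1
    rw [div_lt_div_iff₀ hd he] at h2
    nlinarith [mul_nonneg (sub_nonneg.2 h) (sub_nonneg.2 hde'), mul_pos (sub_pos.2 hlt) hd]

theorem kernel_le_kernel_of_hasLogModulus {ε c : ℝ} (hε : 0 < ε) (hc : 0 ≤ c) {f : X → Y}
    (hf : HasLogModulus ε c f) {s t : ℝ} (hs : 0 < s) (ht : 0 < t)
    (hst : t + Real.log t = s + Real.log s + c) (x y : X) :
    kernel s (dist x y) ≤ kernel (ε + t) (dist (f x) (f y)) := by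
  -- The modulus needs a strict bound `dist x y < d` with `d` positive, so the estimate is proved
  -- for such `d` and `d` then decreases to `dist x y`.
  refine ContinuousWithinAt.closure_le (s := Set.Ioi (dist x y)) (x := dist x y) (f := kernel s)
    (g := fun _ => kernel (ε + t) (dist (f x) (f y))) (by simp)
    (continuous_kernel s).continuousWithinAt continuousWithinAt_const fun d hd => ?_
  have hd0 : 0 < d := dist_nonneg.trans_lt hd
  obtain ⟨e, he, hde⟩ := exists_add_log_eq (d + Real.log d + c)
  have h1 := kernel_le_kernel_of_add_log_eq hs ht hd0 he hc hst hde
  have h2 := kernel_le_kernel_add ht he.le hε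
  have h3 := kernel_anti (add_pos hε ht) dist_nonneg (hf d e hd0 he hde x y hd)
  rw [add_comm t, add_comm e] at h2
  linarith

/-! ### Distances to point masses -/

/-- The function `x ↦ -kernel s (dist x x₀)`. -/
noncomputable def cone (s : ℝ) (x₀ : X) : C(X, ℝ) :=
  ⟨fun x => -kernel s (dist x x₀),
    ((continuous_kernel s).comp (continuous_id.dist continuous_const)).neg⟩

theorem cone_apply (s : ℝ) (x₀ x : X) : cone s x₀ x = -kernel s (dist x x₀) := rfl

variable [CompactSpace X] [CompactSpace Y]

noncomputable instance : MetricSpace (IdempMeas X) := (compatibleMetric X).toMetricSpace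

theorem dist_eq_idist (μ ν : IdempMeas X) : dist μ ν = idist μ ν := rfl

theorem apply_cone_le_zero {s : ℝ} {μ : IdempMeas X} {x₀ : X} (h : idist μ (unit X x₀) < s) :
    μ (cone s x₀) ≤ 0 := by
  have := μ.nonempty
  refine (dominated_of_idist_lt h (cone s x₀)).trans (dilate_le (y := x₀) fun x => ?_)
  rw [cone_apply, ContinuousMap.id_apply, neg_add_cancel]

/-- Up to an additive constant `cone s x₀` majorises every test function, the constant being the
value of its dilation at `x₀`. So this one function decides domination by the point mass; the
reverse domination follows at every larger size. -/
theorem idist_unit_le {s : ℝ} {μ : IdempMeas X} {x₀ : X} (hs : 0 < s) (h : μ (cone s x₀) ≤ 0) :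
    idist μ (unit X x₀) ≤ s := by
  have hdom : Dominated s μ (unit X x₀) := fun φ => by
    refine (μ.apply_le_add (χ := cone s x₀) (c := dilate (ContinuousMap.id X) s φ x₀)
      fun x => ?_).trans (add_le_of_nonpos_left h)
    have := le_dilate (ContinuousMap.id X) s φ x x₀
    rw [ContinuousMap.id_apply] at this
    rw [cone_apply]
    linarith
  refine idist_le_of_forall hs.le fun t hst => ⟨hdom.mono hs hst.le, fun φ => ?_⟩
  have h1 : μ (cone t x₀) < 0 := by
    have := μ.apply_le_add (φ := cone t x₀) (χ := cone s x₀) (c := -(t - s)) fun x => by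
      have := kernel_add_le hs (dist_nonneg (x := x) (y := x₀)) (sub_nonneg.2 hst.le)
      rw [add_sub_cancel] at this
      rw [cone_apply, cone_apply]
      linarith
    linarith
  -- The supremum is the absolute value of the cone. As `μ` preserves maxima, one of the two
  -- functions has nonnegative measure, and `h1` excludes the first.
  have h2 : 0 ≤ μ (cone t x₀ ⊔ -cone t x₀) := μ.const_le_apply fun x =>
    (abs_nonneg (cone t x₀ x)).trans_eq rfl
  rw [μ.2.map_sup] at h2
  have h3 : 0 ≤ μ (-cone t x₀) := (le_max_iff.1 h2).resolve_left h1.not_ge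
  have h4 := μ.apply_le_add (φ := -cone t x₀) (χ := dilate (ContinuousMap.id X) t φ)
    (c := -φ x₀) fun x => by
      have := le_dilate (ContinuousMap.id X) t φ x₀ x
      rw [ContinuousMap.id_apply, dist_comm] at this
      rw [ContinuousMap.neg_apply, cone_apply]
      linarith
  have h5 : (unit X x₀) φ = φ x₀ := rfl
  rw [h5]
  linarith

theorem idist_unit_unit (x y : X) : idist (unit X x) (unit X y) = dist x y := by
  apply le_antisymm
  · refine le_of_forall_gt_imp_ge_of_dense fun s hs => ?_
    refine idist_unit_le (dist_nonneg.trans_lt hs) ?_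
    change -kernel s (dist x y) ≤ 0
    rw [kernel_of_le dist_nonneg hs.le]
    linarith
  · refine le_of_forall_gt_imp_ge_of_dense fun s hs => ?_
    have h : -kernel s (dist x y) ≤ 0 := apply_cone_le_zero hs
    linarith [kernel_le_sub s (dist x y)]

theorem dist_le_idist_unit {ν : IdempMeas X} {y : X} (hy : ∀ φ : C(X, ℝ), φ y ≤ ν φ) (x : X) :
    dist x y ≤ idist (unit X x) ν := by
  refine le_of_forall_gt_imp_ge_of_dense fun s hs => ?_
  have h := (hy _).trans (apply_cone_le_zero ((idist_comm _ _).trans_lt hs))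
  rw [cone_apply, dist_comm] at h
  linarith [kernel_le_sub s (dist x y)]

/-! ### Diameter and isometric embeddings -/

theorem idist_le_diam (μ ν : IdempMeas X) : idist μ ν ≤ Metric.diam (Set.univ : Set X) := by
  refine idist_le_of_forall Metric.diam_nonneg fun s hs => ?_
  have h : ∀ x y : X, dist x y ≤ s := fun x y =>
    (Metric.dist_le_diam_of_mem isCompact_univ.isBounded (Set.mem_univ x)
      (Set.mem_univ y)).trans hs.le
  exact ⟨dominated_of_forall_dist_le h _ _, dominated_of_forall_dist_le h _ _⟩

theorem diam_idempMeas :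
    Metric.diam (Set.univ : Set (IdempMeas X)) = Metric.diam (Set.univ : Set X) := by
  apply le_antisymm
  · exact Metric.diam_le_of_forall_dist_le Metric.diam_nonneg fun μ _ ν _ => idist_le_diam μ ν
  · refine Metric.diam_le_of_forall_dist_le Metric.diam_nonneg fun x _ y _ => ?_
    rw [← idist_unit_unit, ← dist_eq_idist]
    exact Metric.dist_le_diam_of_mem isCompact_univ.isBounded (Set.mem_univ _) (Set.mem_univ _)

theorem idist_map_of_isometry {f : C(X, Y)} (hf : Isometry f) (μ ν : IdempMeas X) :
    idist (map f μ) (map f ν) = idist μ ν := by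
  have hk : ∀ s x y, kernel s (dist x y) ≤ kernel s (dist (f x) (f y)) := fun s x y =>
    (congrArg _ (hf.dist_eq x y)).ge
  apply le_antisymm
  · refine idist_le_of_forall (idist_nonneg _ _) fun s hs => ?_
    exact ⟨(dominated_of_idist_lt hs).map f (hk s),
      (dominated_of_idist_lt ((idist_comm _ _).trans_lt hs)).map f (hk s)⟩
  · refine idist_le_of_forall (idist_nonneg _ _) fun s hs => ?_
    set a := idist (map f μ) (map f ν) with ha
    have ha0 : 0 ≤ a := idist_nonneg _ _
    have e : s = (a + (s - a) / 2) + (s - a) / 2 := by ring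
    have h1 : a < a + (s - a) / 2 := by linarith
    rw [e]
    exact ⟨.of_map hf (by linarith) (by linarith) (dominated_of_idist_lt h1),
      .of_map hf (by linarith) (by linarith)
        (dominated_of_idist_lt ((idist_comm _ _).trans_lt h1))⟩

/-! ### Compatibility with the monad structure -/

/-- For `q = idist μ ν` the measure `ν` dominates `μ` at size `q + r`. By `kernel_comp_le`, the
penalty `kernel s q` paid in `I(X)` turns this into a dilation of size `s + r` in `X`. -/
theorem Dominated.mult {s r : ℝ} (hs : 0 < s) (hr : 0 < r) {M N : IdempMeas (IdempMeas X)}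
    (h : Dominated s M N) : Dominated (s + r) (mult X M) (mult X N) := fun φ => by
  have := M.nonempty
  refine (h (eval φ)).trans (N.apply_mono (χ := eval _) fun ν => dilate_le fun μ => ?_)
  have hX := μ.nonempty
  change μ φ + kernel s (idist μ ν) ≤ ν (dilate (ContinuousMap.id X) (s + r) φ)
  have hq := idist_nonneg μ ν
  have h1 : μ φ ≤ ν (dilate (ContinuousMap.id X) (idist μ ν + r) φ) :=
    dominated_of_idist_lt (lt_add_of_pos_right _ hr) φ
  have h2 := ν.apply_le_add (φ := dilate (ContinuousMap.id X) (idist μ ν + r) φ)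
    (χ := dilate (ContinuousMap.id X) (s + r) φ) (c := -kernel s (idist μ ν)) fun y =>
      dilate_le fun x => by
        have h3 := kernel_comp_le (s := s + r) (q := idist μ ν + r) (d := dist x y) (by linarith)
        have h4 := kernel_le_kernel_add hs hq hr
        have h5 := le_dilate (ContinuousMap.id X) (s + r) φ x y
        rw [ContinuousMap.id_apply] at h5 ⊢
        linarith
  linarith

theorem idist_mult_le (M N : IdempMeas (IdempMeas X)) :
    idist (mult X M) (mult X N) ≤ idist M N := by
  refine idist_le_of_forall (idist_nonneg _ _) fun s hs => ?_
  set a := idist M N with ha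
  have ha0 : 0 ≤ a := idist_nonneg _ _
  have e : s = (a + (s - a) / 2) + (s - a) / 2 := by ring
  have h1 : a < a + (s - a) / 2 := by linarith
  rw [e]
  exact ⟨.mult (by linarith) (by linarith) (dominated_of_idist_lt h1),
    .mult (by linarith) (by linarith) (dominated_of_idist_lt ((idist_comm _ _).trans_lt h1))⟩

/-- Let `q > s` be the distance from `ν` to the point mass. For `s < p < q` the measure of `cone p
x₀` is positive. That cone is nonpositive within radius `p`, and by `kernel_comp_eq` it equals `cone
s x₀ + kernel s p` outside, so `ν (cone s x₀) > -kernel s p`. The slack `r` pays for `p < q`. -/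
theorem neg_kernel_idist_unit_le {s r : ℝ} (hs : 0 < s) (hr : 0 < r) (ν : IdempMeas X) (x₀ : X) :
    -kernel (s + r) (idist ν (unit X x₀)) ≤ max 0 (ν (cone s x₀)) := by
  set q := idist ν (unit X x₀) with hq
  have hq0 : 0 ≤ q := idist_nonneg _ _
  rcases le_or_gt q s with hqs | hqs
  · refine le_max_of_le_left ?_
    rw [kernel_of_le hq0 (by linarith)]
    linarith
  · refine le_max_of_le_right ?_
    obtain ⟨p, hp, hpq⟩ := exists_between (max_lt hqs (sub_lt_self q hr))
    obtain ⟨hsp, hp⟩ := max_lt_iff.1 hp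
    have h1 : 0 < ν (cone p x₀) := by
      by_contra! hcon
      exact hpq.not_ge (idist_unit_le (hs.trans hsp) hcon)
    have h2 : ν (cone p x₀) ≤
        ν (ContinuousMap.const X 0 ⊔ (cone s x₀ + ContinuousMap.const X (kernel s p))) := by
      refine ν.apply_mono fun x => ?_
      change -kernel p (dist x x₀) ≤ max 0 (-kernel s (dist x x₀) + kernel s p)
      rcases le_total (dist x x₀) p with hx | hx
      · refine le_max_of_le_left ?_
        rw [kernel_of_le dist_nonneg hx]
        linarith
      · refine le_max_of_le_right ?_
        linarith [kernel_comp_eq hs hsp.le hx]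
    rw [ν.2.map_sup, ν.2.map_const, apply_add_const] at h2
    have h3 := (lt_max_iff.1 (h1.trans_le h2)).resolve_left (lt_irrefl _)
    have h4 := kernel_le_kernel_add hs (hs.trans hsp).le hr
    have h5 := kernel_anti (s := s + r) (by linarith) hq0 (show q ≤ p + r by linarith)
    linarith

/-- By `neg_kernel_idist_unit_le` the cone about `δ_{x₀}` in `I(X)` lies below the maximum of 0 and
the evaluation at a slightly smaller cone in `X`; `N` of that evaluation is the measure of the
smaller cone under `ψ(N)`. -/
theorem idist_unit_unit_le (N : IdempMeas (IdempMeas X)) (x₀ : X) :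
    idist N (unit (IdempMeas X) (unit X x₀)) ≤ idist (mult X N) (unit X x₀) := by
  refine le_of_forall_gt_imp_ge_of_dense fun t ht => ?_
  obtain ⟨s, hs, hst⟩ := exists_between ht
  have hs0 : 0 < s := (idist_nonneg _ _).trans_lt hs
  have h : N (eval (cone s x₀)) ≤ 0 := apply_cone_le_zero hs
  refine idist_unit_le (hs0.trans hst) ?_
  have h1 : N (cone t (unit X x₀)) ≤ N (ContinuousMap.const _ 0 ⊔ eval (cone s x₀)) := by
    refine N.apply_mono fun ν => ?_
    have := neg_kernel_idist_unit_le hs0 (sub_pos.2 hst) ν x₀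
    rwa [add_sub_cancel] at this
  rw [N.2.map_sup, N.2.map_const, max_eq_left h] at h1
  exact h1

theorem idist_unit_eq (N : IdempMeas (IdempMeas X)) (x₀ : X) :
    idist (mult X N) (unit X x₀) = idist (unit (IdempMeas X) (unit X x₀)) N := by
  rw [idist_comm (unit (IdempMeas X) (unit X x₀))]
  exact le_antisymm (idist_mult_le N (unit (IdempMeas X) (unit X x₀))) (idist_unit_unit_le N x₀)

/-- Take `y` of full density for `ν`. Every `δ_x` is at least as far from `ν` as `x` is from `y`, so
the cone about `y` lies below the cone about `ν` pulled back along `η`. -/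
theorem exists_idist_unit_le (μ ν : IdempMeas X) :
    ∃ y, idist μ (unit X y) ≤ idist (map (unit X) μ) (unit (IdempMeas X) ν) := by
  obtain ⟨y, hy⟩ := ν.exists_apply_le
  refine ⟨y, le_of_forall_gt_imp_ge_of_dense fun s hs => ?_⟩
  have hs0 : 0 < s := (idist_nonneg _ _).trans_lt hs
  have h : μ ((cone s ν).comp (unit X)) ≤ 0 := apply_cone_le_zero hs
  refine idist_unit_le hs0 ((μ.apply_mono fun x => ?_).trans h)
  exact neg_le_neg (kernel_anti hs0 dist_nonneg (dist_le_idist_unit hy x))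

/-! ### Uniformity -/

/-- The constants `ε` and `c` do not deteriorate, which is what makes the estimate uniform over all
iterates. -/
theorem HasLogModulus.map {ε c : ℝ} (hε : 0 < ε) (hc : 0 ≤ c) {f : C(X, Y)}
    (hf : HasLogModulus ε c f) :
    HasLogModulus ε c (IdempMeas.map f) := fun s t hs ht hst μ ν hμν => by
  have hk := kernel_le_kernel_of_hasLogModulus hε hc hf hs ht hst
  exact idist_le (add_pos hε ht) ((dominated_of_idist_lt hμν).map f hk)
    ((dominated_of_idist_lt ((idist_comm _ _).trans_lt hμν)).map f hk)

theorem exists_hasLogModulus (f : C(X, Y)) {ε : ℝ} (hε : 0 < ε) :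
    ∃ c, 0 ≤ c ∧ HasLogModulus ε c f := by
  have huc := CompactSpace.uniformContinuous_of_continuous f.continuous
  obtain ⟨δ, hδ, h⟩ := Metric.uniformContinuous_iff.1 huc ε hε
  set D := Metric.diam (Set.univ : Set Y) + δ with hD
  have hD0 : 0 < D := by positivity
  -- This shift carries `δ` to `D`, which exceeds the diameter of `Y`. Thus pairs at distance at
  -- least `δ` satisfy the modulus trivially, and closer pairs are covered by `ε`.
  refine ⟨D + Real.log D - (δ + Real.log δ), ?_, fun s t hs ht hst x y hxy => ?_⟩
  · have h1 : δ ≤ D := le_add_of_nonneg_left Metric.diam_nonneg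
    linarith [Real.log_le_log hδ h1]
  rcases lt_or_ge (dist x y) δ with hlt | hge
  · linarith [h hlt]
  · have h1 := Real.log_le_log hδ (hge.trans hxy.le)
    have h2 : D ≤ t := le_of_add_log_le ht (by linarith)
    have := Metric.dist_le_diam_of_mem isCompact_univ.isBounded (Set.mem_univ (f x))
      (Set.mem_univ (f y))
    linarith

end Metric

end IdempMeas

/-! ### The perfect metrization -/

namespace MetricLift

/-- The metrization of the functor of idempotent measures by `IdempMeas.idist`. -/
noncomputable def idempLift : MetricLift.{u} := fun X => IdempMeas.compatibleMetric X

theorem hasLogModulus_iterMap {X Y : MetricCompactum.{u}} (f : C(X, Y)) {ε c : ℝ} (hε : 0 < ε)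
    (hc : 0 ≤ c) (hf : IdempMeas.HasLogModulus ε c f) (n : ℕ) :
    IdempMeas.HasLogModulus ε c (idempLift.iterMap f n) := by
  induction n with
  | zero => exact hf
  | succ n ih => exact IdempMeas.HasLogModulus.map hε hc ih

theorem isPerfectMetrization_idempLift : idempLift.{u}.IsPerfectMetrization where
  isometry_map f hf := Isometry.of_dist_eq fun μ ν => IdempMeas.idist_map_of_isometry hf μ ν
  isometry_unit X := Isometry.of_dist_eq fun x y => IdempMeas.idist_unit_unit x y
  diam_eq X := IdempMeas.diam_idempMeas
  uniform_iterMap f ε hε := by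
    obtain ⟨c, hc0, hc⟩ := IdempMeas.exists_hasLogModulus f (half_pos hε)
    have ht : 0 < ε / 4 := by positivity
    -- The number `s` is what the modulus matches with `t = ε / 4`. It does not depend on `n`, and
    -- the images are then within `ε / 2 + ε / 4 < ε`.
    obtain ⟨s, hs, hst⟩ := IdempMeas.exists_add_log_eq (ε / 4 + Real.log (ε / 4) - c)
    refine ⟨s, hs, fun n a b hab => ?_⟩
    have := hasLogModulus_iterMap f (half_pos hε) hc0 hc n s (ε / 4) hs ht (by linarith) a b hab
    linarith
  mult_nonexpanding X M N := IdempMeas.idist_mult_le M N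
  dist_unit_eq X μ x₀ N h := by
    subst h
    exact IdempMeas.idist_unit_eq N x₀
  le_infDist_unit X μ ε h := by
    have hne : (Set.range (idempLift.unit (idempLift.obj X))).Nonempty := ⟨_, μ, rfl⟩
    refine (Metric.le_infDist hne).2 ?_
    rintro _ ⟨ν, rfl⟩
    obtain ⟨y, hy⟩ := IdempMeas.exists_idist_unit_le (X := X) μ ν
    exact (h.trans (Metric.infDist_le_dist_of_mem ⟨y, rfl⟩)).trans hy

end MetricLift

/-- The functor of idempotent probability measures is perfectly metrizable. -/
theorem theorem1 : ∃ m : MetricLift.{u}, m.IsPerfectMetrization := by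
  exact ⟨MetricLift.idempLift, MetricLift.isPerfectMetrization_idempLift⟩
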